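/- **Global convergence of Snipal.** Let $A\in\mathbb R^{m\times n}$, $b\in\mathbb R^m$, $c\in\mathbb R^n$, and let $K=\{x\in\mathbb R^n : l\le x\le u\}$, where components of $l$ and $u$ may be $-\infty$ and $+\infty$. Let $\delta_K$ be the indicator function of $K$ ($0$ on $K$, $+\infty$ elsewhere), $\delta_K^*(z)=\sup_{x\in K}\langle x,z\rangle$ its Fenchel conjugate, and $\Pi_K$ the Euclidean projection onto $K$. Consider the linear programs $$\text{(P)}\quad \min\{c^Tx+\delta_K(x) : Ax=b,\ x\in\mathbb R^n\},\qquad \text{(D)}\quad \max\{-\delta_K^*(A^*y-c)+b^Ty : y\in\mathbb R^m\}.$$ For $\sigma>0$ let $$l(y;x)=-b^Ty-\langle x,c-A^*y\rangle-\delta_K(x),\qquad L_\sigma(y;x)=\sup_{s\in\mathbb R^n}\Big\{l(y;s)-\tfrac1{2\sigma}\|s-x\|^2\Big\}$$ be the Lagrangian and the augmented Lagrangian of (D). Assume that (P) and (D) both have an optimal solution (a feasible point with optimal objective value, which is then finite) and that $A$ has full row rank $m$. Let $\tau_k>0$ be a nonincreasing sequence with $\tau_k\downarrow\tau_\infty>0$,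 let $\sigma_k$ be a nondecreasing sequence with $\sigma_0>0$ and $\sigma_k\uparrow\sigma_\infty\le\infty$, and let $\epsilon_k\ge 0$ with $\sum_{k=0}^\infty\epsilon_k<\infty$. Let $(y^0,x^0)\in\mathbb R^m\times\mathbb R^n$ be arbitrary and let $\{(y^k,x^k)\}$ be any sequence such that, for all $k\ge 0$, with $$\psi_k(y)=L_{\sigma_k}(y;x^k)+\frac{\tau_k}{2\sigma_k}\|y-y^k\|^2,$$ one has $$\text{(A')}\quad \|\nabla\psi_k(y^{k+1})\|\le\frac{\min(\sqrt{\tau_k},1)}{\sigma_k}\,\epsilon_k,\qquad\text{and}\qquad x^{k+1}=\Pi_K\big(x^k-\sigma_k(c-A^*y^{k+1})\big).$$ Then $\{(y^k,x^k)\}$ is bounded, $\{x^k\}$ converges to an optimal solution of (P), and $\{y^k\}$ converges to an optimal solution of (D). -/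

import Mathlib

open Filter Topology Matrix
open scoped RealInnerProductSpace Gradient

/-- Data of a linear program with bound constraints `l ≤ x ≤ u`; the bounds are extended reals, so
that components of `l` and `u` may be `-∞` and `∞`. -/
structure BoxLP (m n : ℕ) where
  A : Matrix (Fin m) (Fin n) ℝ
  b : EuclideanSpace ℝ (Fin m)
  c : EuclideanSpace ℝ (Fin n)
  l : Fin n → EReal
  u : Fin n → EReal

/-- The indicator function `δ_K` of convex analysis: `0` on `K` and `∞` off `K`. -/
noncomputable def convexIndicator {E : Type*} (K : Set E) (x : E) : EReal :=
  open Classical in if x ∈ K then 0 else ⊤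

/-- The Fenchel conjugate `f^*(z) = sup_x (⟨x, z⟩ - f x)`. -/
noncomputable def fenchelConjugate {E : Type*} [NormedAddCommGroup E] [InnerProductSpace ℝ E]
    (f : E → EReal) (z : E) : EReal :=
  ⨆ x : E, ((⟪x, z⟫ : ℝ) : EReal) - f x

/-- `p = Π_K(z)`: the point `p` is a nearest point of `K` to `z`. -/
def IsProjection {E : Type*} [NormedAddCommGroup E] (K : Set E) (z p : E) : Prop :=
  p ∈ K ∧ ∀ d ∈ K, ‖z - p‖ ≤ ‖z - d‖

namespace BoxLP

variable {m n : ℕ}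

/-- `K = {x | l ≤ x ≤ u}`. -/
def K (P : BoxLP m n) : Set (EuclideanSpace ℝ (Fin n)) :=
  {x | ∀ i, P.l i ≤ ((x i : ℝ) : EReal) ∧ ((x i : ℝ) : EReal) ≤ P.u i}

/-- `x ↦ A x`. -/
noncomputable def mulA (P : BoxLP m n) :
    EuclideanSpace ℝ (Fin n) →ₗ[ℝ] EuclideanSpace ℝ (Fin m) :=
  Matrix.toEuclideanLin P.A

/-- `y ↦ A^* y`. -/
noncomputable def mulAT (P : BoxLP m n) :
    EuclideanSpace ℝ (Fin m) →ₗ[ℝ] EuclideanSpace ℝ (Fin n) :=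
  Matrix.toEuclideanLin P.Aᵀ

/-- `c^T x + δ_K(x)`. -/
noncomputable def primalObj (P : BoxLP m n) (x : EuclideanSpace ℝ (Fin n)) : EReal :=
  ((⟪P.c, x⟫ : ℝ) : EReal) + convexIndicator P.K x

/-- `-δ_K^*(A^* y - c) + b^T y`. -/
noncomputable def dualObj (P : BoxLP m n) (y : EuclideanSpace ℝ (Fin m)) : EReal :=
  -fenchelConjugate (convexIndicator P.K) (P.mulAT y - P.c) + ((⟪P.b, y⟫ : ℝ) : EReal)

/-- Optimal solutions of `min {c^T x + δ_K(x) | A x = b}`: feasible points (those with `A x = b`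
and objective value below `∞`) that minimise the objective. -/
def primalSolutions (P : BoxLP m n) : Set (EuclideanSpace ℝ (Fin n)) :=
  {x | P.mulA x = P.b ∧ P.primalObj x < ⊤ ∧
    ∀ x', P.mulA x' = P.b → P.primalObj x ≤ P.primalObj x'}

/-- Optimal solutions of `max -δ_K^*(A^* y - c) + b^T y`: feasible points (those with objective
value above `-∞`) that maximise the objective. -/
def dualSolutions (P : BoxLP m n) : Set (EuclideanSpace ℝ (Fin m)) :=
  {y | ⊥ < P.dualObj y ∧ ∀ y', P.dualObj y' ≤ P.dualObj y}

/-- The Lagrangian `l(y; x) = -b^T y - ⟨x, c - A^* y⟩ - δ_K(x)`. -/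
noncomputable def lagrangian (P : BoxLP m n) (y : EuclideanSpace ℝ (Fin m))
    (x : EuclideanSpace ℝ (Fin n)) : EReal :=
  ((-⟪P.b, y⟫ - ⟪x, P.c - P.mulAT y⟫ : ℝ) : EReal) - convexIndicator P.K x

/-- The augmented Lagrangian `sup_s {l(y; s) - ‖s - x‖² / (2σ)}`, as an extended real. -/
noncomputable def augLagrangianE (P : BoxLP m n) (σ : ℝ) (y : EuclideanSpace ℝ (Fin m))
    (x : EuclideanSpace ℝ (Fin n)) : EReal :=
  ⨆ s : EuclideanSpace ℝ (Fin n), P.lagrangian y s - ((1 / (2 * σ) * ‖s - x‖ ^ 2 : ℝ) : EReal)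

/-- The augmented Lagrangian `L_σ(y; x)` as a real number. -/
noncomputable def augLagrangian (P : BoxLP m n) (σ : ℝ) (y : EuclideanSpace ℝ (Fin m))
    (x : EuclideanSpace ℝ (Fin n)) : ℝ :=
  (P.augLagrangianE σ y x).toReal

/-- For `σ > 0` and nonempty `K` the supremum that defines `L_σ` is finite. -/
theorem coe_augLagrangian (P : BoxLP m n) (hK : P.K.Nonempty) {σ : ℝ} (hσ : 0 < σ)
    (y : EuclideanSpace ℝ (Fin m)) (x : EuclideanSpace ℝ (Fin n)) :
    ((P.augLagrangian σ y x : ℝ) : EReal) = P.augLagrangianE σ y x := by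
  apply EReal.coe_toReal
  · set v := P.c - P.mulAT y with hv
    have hle : P.augLagrangianE σ y x ≤
        ((-⟪P.b, y⟫ - ⟪x, v⟫ + σ / 2 * ‖v‖ ^ 2 : ℝ) : EReal) := by
      refine iSup_le fun s => ?_
      unfold lagrangian convexIndicator
      split_ifs with h
      · rw [sub_zero, ← EReal.coe_sub, EReal.coe_le_coe_iff, ← hv]
        have h1 : ⟪s, v⟫ = ⟪s - x, v⟫ + ⟪x, v⟫ := by rw [← inner_add_left, sub_add_cancel]
        have h2 : -(‖s - x‖ * ‖v‖) ≤ ⟪s - x, v⟫ := (abs_le.1 (abs_real_inner_le_norm _ _)).1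
        have h3 : ‖s - x‖ * ‖v‖ ≤ 1 / (2 * σ) * ‖s - x‖ ^ 2 + σ / 2 * ‖v‖ ^ 2 := by
          have : 1 / (2 * σ) * ‖s - x‖ ^ 2 + σ / 2 * ‖v‖ ^ 2 - ‖s - x‖ * ‖v‖
              = 1 / (2 * σ) * (‖s - x‖ - σ * ‖v‖) ^ 2 := by field_simp; ring
          have h4 : 0 ≤ 1 / (2 * σ) * (‖s - x‖ - σ * ‖v‖) ^ 2 := by positivity
          linarith
        rw [h1]; linarith
      · simp
    exact ne_top_of_le_ne_top (EReal.coe_ne_top _) hle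
  · obtain ⟨s, hs⟩ := hK
    have h := le_iSup (fun s : EuclideanSpace ℝ (Fin n) =>
      P.lagrangian y s - ((1 / (2 * σ) * ‖s - x‖ ^ 2 : ℝ) : EReal)) s
    refine ne_bot_of_le_ne_bot ?_ h
    simp only [lagrangian, convexIndicator, if_pos hs, sub_zero, ← EReal.coe_sub]
    exact EReal.coe_ne_bot _

/-- The inner objective `ψ(y) = L_σ(y; x̄) + τ / (2σ) ‖y - ȳ‖²`. -/
noncomputable def innerObj (P : BoxLP m n) (σ τ : ℝ) (ybar : EuclideanSpace ℝ (Fin m))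
    (xbar : EuclideanSpace ℝ (Fin n)) (y : EuclideanSpace ℝ (Fin m)) : ℝ :=
  P.augLagrangian σ y xbar + τ / (2 * σ) * ‖y - ybar‖ ^ 2

/-- `(y, x)` is generated by the method with penalty parameters `σ`, proximal parameters `τ` and
tolerances `ε`: for every `k`, the point `y (k + 1)` minimises the inner objective `ψ_k` up to the
gradient tolerance `min (√τ_k) 1 / σ_k * ε_k`, and
`x (k + 1) = Π_K (x k - σ_k (c - A^* y (k + 1)))`. -/
structure IsSnipalSequence (P : BoxLP m n) (σ τ ε : ℕ → ℝ)
    (y : ℕ → EuclideanSpace ℝ (Fin m)) (x : ℕ → EuclideanSpace ℝ (Fin n)) : Prop where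
  step_y : ∀ k, ‖∇ (P.innerObj (σ k) (τ k) (y k) (x k)) (y (k + 1))‖ ≤
    min (√(τ k)) 1 / σ k * ε k
  step_x : ∀ k, IsProjection P.K (x k - σ k • (P.c - P.mulAT (y (k + 1)))) (x (k + 1))

end BoxLP

/-! The method is an inexact proximal point iteration for the monotone KKT system `A x = b`, `A^* y
- c ∈ N_K(x)`, in the norm `τ_k ‖y‖² + ‖x‖²`. By an envelope argument `L_σ(·; x)` has gradient `A
Π_K(x - σ (c - A^* y)) - b`, so (A') bounds the residual `σ_k (A x^{k+1} - b) + τ_k (y^{k+1} - y^k)`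
(`norm_residual_le`), while the projection supplies a variational inequality for `x^{k+1}`.

Testing both against a KKT pair gives a quasi-Fejér inequality with summable errors (`fejer`). As
`τ_k` does not increase, the weighted distance to every KKT pair converges and the increments vanish
(`exists_tendsto_of_quasiFejer`). A KKT pair exists by Farkas' lemma (`exists_isKKT`), so the
iterates are bounded. Every cluster point is a KKT pair (`isKKT_of_tendsto`); the distance to it
converges and tends to `0` along a subsequence, hence tends to `0`. -/

/-! ### Finitely generated cones -/

/-- **Farkas' lemma**: a linear functional that is nonnegative wherever finitely many linear
functionals are all nonnegative is a nonnegative combination of them. -/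
theorem Module.Dual.exists_nonneg_combination {V ι : Type*} [AddCommGroup V] [Module ℝ V]
    (s : Finset ι) (f : ι → Module.Dual ℝ V) (g : Module.Dual ℝ V)
    (h : ∀ v, (∀ i ∈ s, 0 ≤ f i v) → 0 ≤ g v) :
    ∃ w : ι → ℝ, (∀ i, 0 ≤ w i) ∧ ∀ v, g v = ∑ i ∈ s, w i * f i v := by
  classical
  induction s using Finset.induction_on generalizing f g with
  | empty =>
    refine ⟨0, fun _ => le_rfl, fun v => ?_⟩
    have h1 := h v (by simp)
    have h2 := h (-v) (by simp)
    rw [map_neg] at h2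
    simp only [Finset.sum_empty]
    linarith
  | insert a s ha ih =>
    by_cases hs : ∀ v, (∀ i ∈ s, 0 ≤ f i v) → 0 ≤ g v
    · obtain ⟨w, hw, hg⟩ := ih f g hs
      refine ⟨Function.update w a 0, fun i => ?_, fun v => ?_⟩
      · by_cases hi : i = a
        · simp [hi]
        · simpa [hi] using hw i
      · rw [Finset.sum_insert ha, Function.update_self, zero_mul, zero_add, hg]
        refine Finset.sum_congr rfl fun i hi => ?_
        rw [Function.update_of_ne (ne_of_mem_of_not_mem hi ha)]
    · push Not at hs
      -- The constraint `a` matters, and `p` violates it. Projecting along `p` onto `ker (f a)`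
      -- removes `a`, so induction applies to the projected functionals.
      obtain ⟨p, hp, hgp⟩ := hs
      have hap : f a p < 0 := by
        by_contra hc
        exact absurd (h p fun i hi => (Finset.mem_insert.1 hi).elim
          (fun e => e ▸ not_lt.1 hc) (hp i)) (not_le.2 hgp)
      have hproj : ∀ (q : Module.Dual ℝ V) v,
          q (v - (f a v / f a p) • p) = (q - (q p / f a p) • f a) v := fun q v => by
        simp only [map_sub, map_smul, LinearMap.sub_apply, LinearMap.smul_apply, smul_eq_mul]
        ring
      obtain ⟨w, hw, hg⟩ := ih (fun i => f i - (f i p / f a p) • f a)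
        (g - (g p / f a p) • f a) fun v hv => by
          rw [← hproj]
          refine h _ fun i hi => (Finset.mem_insert.1 hi).elim (fun e => ?_) fun hi => ?_
          · rw [e, hproj, div_self hap.ne]
            simp
          · rw [hproj]
            exact hv i hi
      -- The weight of `a` is forced by evaluating the identity at `p`; it is a quotient of two
      -- nonpositive numbers.
      refine ⟨Function.update w a ((g p - ∑ i ∈ s, w i * f i p) / f a p), fun i => ?_, fun v => ?_⟩
      · by_cases hi : i = a
        · subst hi
          rw [Function.update_self]
          refine div_nonneg_of_nonpos ?_ hap.le
          have := Finset.sum_nonneg fun i hi => mul_nonneg (hw i) (hp i hi)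
          linarith
        · simpa [hi] using hw i
      · rw [Finset.sum_insert ha, Function.update_self]
        have h1 : ∑ i ∈ s, Function.update w a ((g p - ∑ i ∈ s, w i * f i p) / f a p) i * f i v
            = ∑ i ∈ s, w i * f i v := Finset.sum_congr rfl fun i hi => by
          rw [Function.update_of_ne (ne_of_mem_of_not_mem hi ha)]
        have h2 := hg v
        simp only [LinearMap.sub_apply, LinearMap.smul_apply, smul_eq_mul, mul_sub,
          Finset.sum_sub_distrib] at h2
        have h3 : ∑ i ∈ s, w i * (f i p / f a p * f a v)
            = (∑ i ∈ s, w i * f i p) * (f a v / f a p) := by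
          rw [Finset.sum_mul]
          exact Finset.sum_congr rfl fun i _ => by ring
        rw [h3] at h2
        rw [h1]
        linear_combination h2

/-! ### KKT pairs and linear programming duality -/

namespace BoxLP

variable {m n : ℕ} {P : BoxLP m n}

theorem inner_mulAT (P : BoxLP m n) (y : EuclideanSpace ℝ (Fin m))
    (x : EuclideanSpace ℝ (Fin n)) : ⟪x, P.mulAT y⟫ = ⟪P.mulA x, y⟫ := by
  have h : P.mulAT = P.mulA.adjoint := by
    have := Matrix.toEuclideanLin_conjTranspose_eq_adjoint P.A
    rwa [Matrix.conjTranspose_eq_transpose_of_trivial] at this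
  rw [h, LinearMap.adjoint_inner_right]

theorem convex_K (P : BoxLP m n) : Convex ℝ P.K := by
  intro s hs t ht a b ha hb hab i
  have hconv : ∀ p q : ℝ, min p q ≤ a * p + b * q ∧ a * p + b * q ≤ max p q := fun p q => by
    have h1 : a * min p q + b * min p q = min p q := by rw [← add_mul, hab, one_mul]
    have h2 : a * max p q + b * max p q = max p q := by rw [← add_mul, hab, one_mul]
    constructor
    · rw [← h1]; gcongr <;> simp
    · rw [← h2]; gcongr <;> simp
  obtain ⟨h1, h2⟩ := hconv (s i) (t i)
  simp only [PiLp.add_apply, PiLp.smul_apply, smul_eq_mul]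
  constructor
  · refine le_trans ?_ (EReal.coe_le_coe_iff.2 h1)
    rcases min_choice (s i) (t i) with h | h <;> rw [h]
    exacts [(hs i).1, (ht i).1]
  · refine le_trans (EReal.coe_le_coe_iff.2 h2) ?_
    rcases max_choice (s i) (t i) with h | h <;> rw [h]
    exacts [(hs i).2, (ht i).2]

theorem isClosed_K (P : BoxLP m n) : IsClosed P.K := by
  have hc : ∀ i, Continuous fun x : EuclideanSpace ℝ (Fin n) => ((x i : ℝ) : EReal) := fun i =>
    continuous_coe_real_ereal.comp (by fun_prop)
  simp only [K, Set.ofPred_forall]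
  exact isClosed_iInter fun i =>
    (isClosed_le continuous_const (hc i)).inter (isClosed_le (hc i) continuous_const)

/-- The Karush-Kuhn-Tucker conditions `A x = b`, `x ∈ K`, `A^* y - c ∈ N_K(x)`. -/
structure IsKKT (P : BoxLP m n) (y : EuclideanSpace ℝ (Fin m))
    (x : EuclideanSpace ℝ (Fin n)) : Prop where
  mem_K : x ∈ P.K
  mulA_eq : P.mulA x = P.b
  inner_nonneg : ∀ s ∈ P.K, 0 ≤ ⟪P.c - P.mulAT y, s - x⟫

theorem primalObj_of_mem {x : EuclideanSpace ℝ (Fin n)} (hx : x ∈ P.K) :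
    P.primalObj x = ((⟪P.c, x⟫ : ℝ) : EReal) := by
  simp [primalObj, convexIndicator, hx]

theorem primalObj_of_notMem {x : EuclideanSpace ℝ (Fin n)} (hx : x ∉ P.K) :
    P.primalObj x = ⊤ := by
  simp [primalObj, convexIndicator, hx]

theorem mem_primalSolutions_iff {x : EuclideanSpace ℝ (Fin n)} :
    x ∈ P.primalSolutions ↔
      P.mulA x = P.b ∧ x ∈ P.K ∧ ∀ s ∈ P.K, P.mulA s = P.b → ⟪P.c, x⟫ ≤ ⟪P.c, s⟫ := by
  refine and_congr_right fun _ => ⟨fun h => ?_, fun h => ?_⟩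
  · have hx : x ∈ P.K := by
      by_contra hx
      exact h.1.ne (primalObj_of_notMem hx)
    refine ⟨hx, fun s hs hb => ?_⟩
    have := h.2 s hb
    rwa [primalObj_of_mem hx, primalObj_of_mem hs, EReal.coe_le_coe_iff] at this
  · refine ⟨primalObj_of_mem h.1 ▸ EReal.coe_lt_top _, fun s hb => ?_⟩
    by_cases hs : s ∈ P.K
    · rw [primalObj_of_mem h.1, primalObj_of_mem hs, EReal.coe_le_coe_iff]
      exact h.2 s hs hb
    · rw [primalObj_of_notMem hs]
      exact le_top

theorem IsKKT.mem_primalSolutions {y : EuclideanSpace ℝ (Fin m)} {x : EuclideanSpace ℝ (Fin n)}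
    (h : P.IsKKT y x) : x ∈ P.primalSolutions := by
  refine mem_primalSolutions_iff.2 ⟨h.mulA_eq, h.mem_K, fun s hs hb => ?_⟩
  have h1 := h.inner_nonneg s hs
  have h2 : ⟪P.mulAT y, s - x⟫ = 0 := by
    rw [real_inner_comm, inner_mulAT, map_sub, hb, h.mulA_eq, sub_self, inner_zero_left]
  rw [inner_sub_left, h2, inner_sub_right] at h1
  linarith

theorem dualObj_le {x : EuclideanSpace ℝ (Fin n)} (hx : x ∈ P.K) (hb : P.mulA x = P.b)
    (y : EuclideanSpace ℝ (Fin m)) : P.dualObj y ≤ ((⟪P.c, x⟫ : ℝ) : EReal) := by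
  have h1 : ((⟪x, P.mulAT y - P.c⟫ : ℝ) : EReal) ≤
      fenchelConjugate (convexIndicator P.K) (P.mulAT y - P.c) := by
    refine le_trans ?_ (le_iSup _ x)
    simp [convexIndicator, hx]
  calc P.dualObj y ≤ -((⟪x, P.mulAT y - P.c⟫ : ℝ) : EReal) + ((⟪P.b, y⟫ : ℝ) : EReal) :=
        add_le_add_left (EReal.neg_le_neg_iff.2 h1) _
    _ = _ := by
        rw [← EReal.coe_neg, ← EReal.coe_add, inner_sub_right, inner_mulAT, hb,
          real_inner_comm x]
        congr 1
        ring

/-- The KKT inequality says that `x` attains the supremum defining the conjugate, so weak duality is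
tight. -/
theorem IsKKT.dualObj_eq {y : EuclideanSpace ℝ (Fin m)} {x : EuclideanSpace ℝ (Fin n)}
    (h : P.IsKKT y x) : P.dualObj y = ((⟪P.c, x⟫ : ℝ) : EReal) := by
  refine le_antisymm (dualObj_le h.mem_K h.mulA_eq y) ?_
  have h1 : fenchelConjugate (convexIndicator P.K) (P.mulAT y - P.c) ≤
      ((⟪x, P.mulAT y - P.c⟫ : ℝ) : EReal) := by
    refine iSup_le fun s => ?_
    by_cases hs : s ∈ P.K
    · simp only [convexIndicator, hs, if_true, sub_zero, EReal.coe_le_coe_iff]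
      have := h.inner_nonneg s hs
      rw [← neg_sub, inner_neg_left, inner_sub_right, real_inner_comm s, real_inner_comm x] at this
      linarith
    · simp [convexIndicator, hs]
  calc ((⟪P.c, x⟫ : ℝ) : EReal)
      = -((⟪x, P.mulAT y - P.c⟫ : ℝ) : EReal) + ((⟪P.b, y⟫ : ℝ) : EReal) := by
        rw [← EReal.coe_neg, ← EReal.coe_add, inner_sub_right, inner_mulAT, h.mulA_eq,
          real_inner_comm x]
        congr 1
        ring
    _ ≤ P.dualObj y := add_le_add_left (EReal.neg_le_neg_iff.2 h1) _

theorem IsKKT.mem_dualSolutions {y : EuclideanSpace ℝ (Fin m)} {x : EuclideanSpace ℝ (Fin n)}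
    (h : P.IsKKT y x) : y ∈ P.dualSolutions :=
  ⟨h.dualObj_eq ▸ EReal.bot_lt_coe _,
    fun y' => h.dualObj_eq ▸ dualObj_le h.mem_K h.mulA_eq y'⟩

/-- Inactive bounds survive small steps by continuity, so only active ones constrain `d`. This
yields the feasible directions for Farkas' lemma. -/
theorem eventually_add_smul_mem_K {x d : EuclideanSpace ℝ (Fin n)} (hx : x ∈ P.K)
    (hl : ∀ i, P.l i = ((x i : ℝ) : EReal) → 0 ≤ d i)
    (hu : ∀ i, P.u i = ((x i : ℝ) : EReal) → d i ≤ 0) :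
    ∀ᶠ t : ℝ in 𝓝[>] 0, x + t • d ∈ P.K := by
  have hcont : ∀ i, Tendsto (fun t : ℝ => ((x i + t * d i : ℝ) : EReal)) (𝓝[>] 0)
      (𝓝 ((x i : ℝ) : EReal)) := fun i => by
    have h : Continuous fun t : ℝ => ((x i + t * d i : ℝ) : EReal) :=
      continuous_coe_real_ereal.comp (by fun_prop)
    have := (h.tendsto 0).mono_left (nhdsWithin_le_nhds (s := Set.Ioi 0))
    rwa [zero_mul, add_zero] at this
  refine eventually_all.2 fun i => Eventually.and ?_ ?_
  · rcases (hx i).1.eq_or_lt with h | h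
    · filter_upwards [self_mem_nhdsWithin] with t ht
      rw [h, EReal.coe_le_coe_iff]
      simpa using mul_nonneg (le_of_lt ht) (hl i h)
    · exact ((hcont i).eventually (lt_mem_nhds h)).mono fun t ht => le_of_lt ht
  · rcases (hx i).2.eq_or_lt with h | h
    · filter_upwards [self_mem_nhdsWithin] with t ht
      rw [← h, EReal.coe_le_coe_iff]
      simpa using mul_nonpos_of_nonneg_of_nonpos (le_of_lt ht) (hu i h.symm)
    · exact ((hcont i).eventually (gt_mem_nhds h)).mono fun t ht => le_of_lt ht

/-- Strong duality: a primal solution admits a multiplier. -/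
theorem exists_isKKT {x : EuclideanSpace ℝ (Fin n)} (hx : x ∈ P.primalSolutions) :
    ∃ y, P.IsKKT y x := by
  classical
  obtain ⟨hb, hK, hopt⟩ := mem_primalSolutions_iff.1 hx
  -- Each equation becomes two opposite inequalities; an inactive bound contributes the zero
  -- functional.
  let eq : Fin m → Module.Dual ℝ (EuclideanSpace ℝ (Fin n)) := fun j =>
    (EuclideanSpace.proj (𝕜 := ℝ) j).toLinearMap ∘ₗ P.mulA
  let co : Fin n → Module.Dual ℝ (EuclideanSpace ℝ (Fin n)) := fun i =>
    (EuclideanSpace.proj (𝕜 := ℝ) i).toLinearMap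
  let lo : Fin n → Module.Dual ℝ (EuclideanSpace ℝ (Fin n)) := fun i =>
    if P.l i = ((x i : ℝ) : EReal) then co i else 0
  let up : Fin n → Module.Dual ℝ (EuclideanSpace ℝ (Fin n)) := fun i =>
    if P.u i = ((x i : ℝ) : EReal) then -co i else 0
  obtain ⟨w, hw, hg⟩ := Module.Dual.exists_nonneg_combination Finset.univ
    (Sum.elim (Sum.elim eq (fun j => -eq j)) (Sum.elim lo up))
    (innerSL ℝ P.c).toLinearMap fun d hd => by
      have hA : P.mulA d = 0 := by
        ext j
        have h1 : 0 ≤ eq j d := hd (.inl (.inl j)) (Finset.mem_univ _)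
        have h2 : 0 ≤ -eq j d := hd (.inl (.inr j)) (Finset.mem_univ _)
        exact le_antisymm (neg_nonneg.1 h2) h1
      obtain ⟨t, ht, ht0⟩ := ((eventually_add_smul_mem_K (d := d) hK
        (fun i hi => by
          have : 0 ≤ lo i d := hd (.inr (.inl i)) (Finset.mem_univ _)
          simp only [lo, if_pos hi] at this
          exact this)
        (fun i hi => by
          have : 0 ≤ up i d := hd (.inr (.inr i)) (Finset.mem_univ _)
          simp only [up, if_pos hi] at this
          exact neg_nonneg.1 this)).and self_mem_nhdsWithin).exists
      have := hopt _ ht (by rw [map_add, map_smul, hA, smul_zero, add_zero, hb])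
      rw [inner_add_right, inner_smul_right] at this
      have h : 0 ≤ t * ⟪P.c, d⟫ := by linarith
      exact nonneg_of_mul_nonneg_right h (Set.mem_Ioi.1 ht0)
  -- The multiplier of an equation is the difference of its two weights; the bound terms then make
  -- up `c - A^* y`.
  refine ⟨WithLp.toLp 2 fun j => w (.inl (.inl j)) - w (.inl (.inr j)), hK, hb, fun s hs => ?_⟩
  have h1 := hg (s - x)
  simp only [Fintype.sum_sum_type, Sum.elim_inl, Sum.elim_inr] at h1
  have h2 : ⟪P.mulAT (WithLp.toLp 2 fun j => w (.inl (.inl j)) - w (.inl (.inr j))), s - x⟫ =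
      ∑ j, w (.inl (.inl j)) * eq j (s - x) + ∑ j, w (.inl (.inr j)) * (-eq j) (s - x) := by
    rw [real_inner_comm, inner_mulAT, PiLp.inner_apply, ← Finset.sum_add_distrib]
    refine Finset.sum_congr rfl fun j _ => ?_
    change _ * (P.mulA (s - x)) j = _ * (P.mulA (s - x)) j + _ * -(P.mulA (s - x)) j
    ring
  have h3 : ∀ i, 0 ≤ lo i (s - x) := fun i => by
    by_cases hi : P.l i = ((x i : ℝ) : EReal)
    · simp only [lo, if_pos hi]
      have := (hs i).1
      rw [hi, EReal.coe_le_coe_iff] at this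
      exact sub_nonneg.2 this
    · simp [lo, if_neg hi]
  have h4 : ∀ i, 0 ≤ up i (s - x) := fun i => by
    by_cases hi : P.u i = ((x i : ℝ) : EReal)
    · simp only [up, if_pos hi]
      have := (hs i).2
      rw [hi, EReal.coe_le_coe_iff] at this
      exact neg_nonneg.2 (sub_nonpos.2 this)
    · simp [up, if_neg hi]
  rw [inner_sub_left, h2]
  change ⟪P.c, s - x⟫ = _ at h1
  rw [h1, add_sub_cancel_left]
  exact add_nonneg (Finset.sum_nonneg fun i _ => mul_nonneg (hw _) (h3 i))
    (Finset.sum_nonneg fun i _ => mul_nonneg (hw _) (h4 i))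

end BoxLP

/-! ### Projections and quasi-Fejér sequences -/

theorem IsProjection.inner_le_zero {E : Type*} [NormedAddCommGroup E] [InnerProductSpace ℝ E]
    {K : Set E} (hK : Convex ℝ K) {z p : E} (h : IsProjection K z p) :
    ∀ s ∈ K, ⟪z - p, s - p⟫ ≤ 0 := by
  refine (norm_eq_iInf_iff_real_inner_le_zero hK h.1).1 (le_antisymm ?_ ?_)
  · have : Nonempty K := ⟨⟨p, h.1⟩⟩
    exact le_ciInf fun s => h.2 s s.2
  · exact ciInf_le (f := fun w : K => ‖z - w‖) ⟨0, by rintro _ ⟨w, rfl⟩; exact norm_nonneg _⟩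
      ⟨p, h.1⟩

/-- A quasi-Fejér recursion with summable errors forces convergence and vanishing increments. -/
theorem exists_tendsto_of_quasiFejer {d r s ε : ℕ → ℝ} (hd : ∀ k, 0 ≤ d k)
    (hs : ∀ k, 0 ≤ s k) (hε : ∀ k, 0 ≤ ε k) (hsum : Summable ε)
    (hrs : ∀ k, r k ^ 2 + s k ≤ d k ^ 2 + 2 * ε k * r k) (hdr : ∀ k, d (k + 1) ≤ r k) :
    (∃ L, Tendsto d atTop (𝓝 L)) ∧ Tendsto s atTop (𝓝 0) := by
  have hrd : ∀ k, r k ≤ d k + 2 * ε k := fun k => by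
    have h1 := hrs k
    -- Completing the square in `r k`, and dropping `s k`.
    have h2 : (r k - ε k) ^ 2 ≤ (d k + ε k) ^ 2 := by
      nlinarith [hs k, mul_nonneg (hd k) (hε k)]
    have h3 := abs_le_of_sq_le_sq h2 (add_nonneg (hd k) (hε k))
    linarith [(le_abs_self _).trans h3]
  -- Subtracting the accumulated errors makes `d` monotone.
  let g : ℕ → ℝ := fun k => d k - 2 * ∑ i ∈ Finset.range k, ε i
  have hg : Antitone g := antitone_nat_of_succ_le fun k => by
    simp only [g, Finset.sum_range_succ]
    linarith [hrd k, hdr k]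
  have hbdd : BddBelow (Set.range g) := ⟨-(2 * ∑' i, ε i), by
    rintro _ ⟨k, rfl⟩
    have := hsum.sum_le_tsum (Finset.range k) fun i _ => hε i
    simp only [g]
    linarith [hd k]⟩
  have hlim : Tendsto d atTop (𝓝 ((⨅ k, g k) + 2 * ∑' i, ε i)) := by
    have := (tendsto_atTop_ciInf hg hbdd).add (hsum.hasSum.tendsto_sum_nat.const_mul 2)
    simpa [g] using this
  refine ⟨⟨_, hlim⟩, ?_⟩
  have hε0 := hsum.tendsto_atTop_zero
  have hrlim : Tendsto r atTop (𝓝 ((⨅ k, g k) + 2 * ∑' i, ε i)) :=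
    tendsto_of_tendsto_of_tendsto_of_le_of_le (hlim.comp (tendsto_add_atTop_nat 1))
      (by simpa using hlim.add (hε0.const_mul 2)) hdr hrd
  refine squeeze_zero hs (fun k => ?_) (g := fun k => d k ^ 2 + 2 * ε k * r k - r k ^ 2) ?_
  · linarith [hrs k]
  · simpa using ((hlim.pow 2).add ((hε0.const_mul 2).mul hrlim)).sub (hrlim.pow 2)

/-! ### The augmented Lagrangian and its gradient -/

namespace BoxLP

variable {m n : ℕ} {P : BoxLP m n}

/-- The function of `s` whose supremum over `K` is the augmented Lagrangian. -/
noncomputable def penalized (P : BoxLP m n) (σ : ℝ) (y : EuclideanSpace ℝ (Fin m))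
    (x s : EuclideanSpace ℝ (Fin n)) : ℝ :=
  -⟪P.b, y⟫ - ⟪s, P.c - P.mulAT y⟫ - 1 / (2 * σ) * ‖s - x‖ ^ 2

theorem penalized_le_augLagrangian {σ : ℝ} (hσ : 0 < σ) (y : EuclideanSpace ℝ (Fin m))
    (x : EuclideanSpace ℝ (Fin n)) {s : EuclideanSpace ℝ (Fin n)} (hs : s ∈ P.K) :
    P.penalized σ y x s ≤ P.augLagrangian σ y x := by
  rw [← EReal.coe_le_coe_iff, coe_augLagrangian P ⟨s, hs⟩ hσ]
  refine le_trans (le_of_eq ?_) (le_iSup _ s)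
  simp only [penalized, lagrangian, convexIndicator, if_pos hs, sub_zero, ← EReal.coe_sub]

theorem augLagrangian_le (hK : P.K.Nonempty) {σ : ℝ} (hσ : 0 < σ) {y : EuclideanSpace ℝ (Fin m)}
    {x : EuclideanSpace ℝ (Fin n)} {B : ℝ} (h : ∀ s ∈ P.K, P.penalized σ y x s ≤ B) :
    P.augLagrangian σ y x ≤ B := by
  rw [← EReal.coe_le_coe_iff, coe_augLagrangian P hK hσ]
  refine iSup_le fun s => ?_
  by_cases hs : s ∈ P.K
  · simp only [lagrangian, convexIndicator, if_pos hs, sub_zero, ← EReal.coe_sub]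
    exact EReal.coe_le_coe_iff.2 (h s hs)
  · simp [lagrangian, convexIndicator, hs]

theorem penalized_eq_add (P : BoxLP m n) (σ : ℝ) (y y₀ : EuclideanSpace ℝ (Fin m))
    (x s : EuclideanSpace ℝ (Fin n)) :
    P.penalized σ y x s = P.penalized σ y₀ x s + ⟪P.mulA s - P.b, y - y₀⟫ := by
  simp only [penalized, inner_sub_left, inner_sub_right, inner_mulAT]
  ring

/-- In `s`, `penalized` is a constant minus `‖s - (x - σ (c - A^* y))‖² / (2σ)`, so the projection
maximises it over `K`, and strong concavity gives the quadratic gap. -/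
theorem penalized_le_of_isProjection {σ : ℝ} (hσ : 0 < σ) {y : EuclideanSpace ℝ (Fin m)}
    {x p s : EuclideanSpace ℝ (Fin n)}
    (hp : IsProjection P.K (x - σ • (P.c - P.mulAT y)) p) (hs : s ∈ P.K) :
    P.penalized σ y x s ≤ P.penalized σ y x p - 1 / (2 * σ) * ‖s - p‖ ^ 2 := by
  have h1 := hp.inner_le_zero P.convex_K s hs
  set v := P.c - P.mulAT y with hv
  have h2 : ‖s - x‖ ^ 2 = ‖s - p‖ ^ 2 + 2 * ⟪s - p, p - x⟫ + ‖p - x‖ ^ 2 := by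
    rw [← norm_add_sq_real, sub_add_sub_cancel]
  have h3 : ⟪x - σ • v - p, s - p⟫ = -⟪s - p, p - x⟫ - σ * (⟪s, v⟫ - ⟪p, v⟫) := by
    rw [← inner_sub_left, ← inner_smul_right, ← inner_neg_right, ← inner_sub_right,
      real_inner_comm]
    congr 1
    abel
  have h4 : 0 ≤ 1 / σ * (⟪s - p, p - x⟫ + σ * (⟪s, v⟫ - ⟪p, v⟫)) :=
    mul_nonneg (by positivity) (by linarith)
  have h5 : 1 / σ * (⟪s - p, p - x⟫ + σ * (⟪s, v⟫ - ⟪p, v⟫)) =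
      1 / (2 * σ) * (2 * ⟪s - p, p - x⟫) + (⟪s, v⟫ - ⟪p, v⟫) := by
    field_simp
  simp only [penalized, ← hv, h2]
  rw [h5] at h4
  linarith

/-- The envelope theorem for the augmented Lagrangian, with a quadratic remainder. -/
theorem augLagrangian_sub_mem_Icc {σ : ℝ} (hσ : 0 < σ) {y₀ : EuclideanSpace ℝ (Fin m)}
    {x p : EuclideanSpace ℝ (Fin n)}
    (hp : IsProjection P.K (x - σ • (P.c - P.mulAT y₀)) p) (y : EuclideanSpace ℝ (Fin m)) :
    P.augLagrangian σ y x - P.augLagrangian σ y₀ x - ⟪P.mulA p - P.b, y - y₀⟫ ∈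
      Set.Icc 0 (σ / 2 * ‖P.mulAT (y - y₀)‖ ^ 2) := by
  have h0 : P.augLagrangian σ y₀ x = P.penalized σ y₀ x p := by
    refine le_antisymm (augLagrangian_le ⟨p, hp.1⟩ hσ fun s hs => ?_)
      (penalized_le_augLagrangian hσ _ _ hp.1)
    have := penalized_le_of_isProjection hσ hp hs
    have : 0 ≤ 1 / (2 * σ) * ‖s - p‖ ^ 2 := by positivity
    linarith
  rw [h0]
  constructor
  · have := penalized_le_augLagrangian hσ y x hp.1
    rw [penalized_eq_add P σ y y₀] at this
    linarith
  · have : P.augLagrangian σ y x ≤ P.penalized σ y₀ x p + ⟪P.mulA p - P.b, y - y₀⟫ +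
        σ / 2 * ‖P.mulAT (y - y₀)‖ ^ 2 := by
      refine augLagrangian_le ⟨p, hp.1⟩ hσ fun s hs => ?_
      rw [penalized_eq_add P σ y y₀]
      have h1 := penalized_le_of_isProjection hσ hp hs
      have h2 : ⟪P.mulA s - P.b, y - y₀⟫ =
          ⟪P.mulA p - P.b, y - y₀⟫ + ⟪s - p, P.mulAT (y - y₀)⟫ := by
        rw [inner_mulAT, ← inner_add_left, map_sub]
        congr 1
        abel
      -- The quadratic gap absorbs the term linear in `s - p`, at the cost `σ / 2 * ‖A^* (y -
      -- y₀)‖²`.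
      have h3 := real_inner_le_norm (s - p) (P.mulAT (y - y₀))
      have h4 : 1 / (2 * σ) * ‖s - p‖ ^ 2 + σ / 2 * ‖P.mulAT (y - y₀)‖ ^ 2 -
          ‖s - p‖ * ‖P.mulAT (y - y₀)‖ =
          1 / (2 * σ) * (‖s - p‖ - σ * ‖P.mulAT (y - y₀)‖) ^ 2 := by
        field_simp
        ring
      have h5 : 0 ≤ 1 / (2 * σ) * (‖s - p‖ - σ * ‖P.mulAT (y - y₀)‖) ^ 2 := by positivity
      linarith
    linarith

/-- Since `∇` defaults to `0` where a function is not differentiable, the tolerance carries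
information only through this lemma. -/
theorem hasGradientAt_innerObj {σ τ : ℝ} (hσ : 0 < σ) (hτ : 0 < τ)
    {y₀ ybar : EuclideanSpace ℝ (Fin m)} {x p : EuclideanSpace ℝ (Fin n)}
    (hp : IsProjection P.K (x - σ • (P.c - P.mulAT y₀)) p) :
    HasGradientAt (P.innerObj σ τ ybar x) (P.mulA p - P.b + (τ / σ) • (y₀ - ybar)) y₀ := by
  rw [hasGradientAt_iff_isLittleO]
  refine Asymptotics.IsBigO.trans_isLittleO (g := fun y => ‖y - y₀‖ ^ 2) ?_
    (Asymptotics.isLittleO_norm_right.1 (Asymptotics.isLittleO_norm_pow_id one_lt_two |>.comp_tendsto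
      (tendsto_sub_nhds_zero_iff.2 tendsto_id) |>.norm_right))
  let T := P.mulAT.toContinuousLinearMap
  refine Asymptotics.IsBigO.of_bound (σ / 2 * ‖T‖ ^ 2 + τ / (2 * σ)) (.of_forall fun y => ?_)
  have h1 := augLagrangian_sub_mem_Icc hσ hp y
  have h2 : ‖y - ybar‖ ^ 2 =
      ‖y - y₀‖ ^ 2 + 2 * ⟪y₀ - ybar, y - y₀⟫ + ‖y₀ - ybar‖ ^ 2 := by
    rw [real_inner_comm, ← norm_add_sq_real, sub_add_sub_cancel]
  have h3 : P.innerObj σ τ ybar x y - P.innerObj σ τ ybar x y₀ -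
      ⟪P.mulA p - P.b + (τ / σ) • (y₀ - ybar), y - y₀⟫ =
      (P.augLagrangian σ y x - P.augLagrangian σ y₀ x - ⟪P.mulA p - P.b, y - y₀⟫) +
        τ / (2 * σ) * ‖y - y₀‖ ^ 2 := by
    simp only [innerObj]
    rw [h2, inner_add_left, real_inner_smul_left]
    field_simp
    ring
  have h4 : ‖P.mulAT (y - y₀)‖ ^ 2 ≤ ‖T‖ ^ 2 * ‖y - y₀‖ ^ 2 := by
    rw [← mul_pow]
    exact pow_le_pow_left₀ (norm_nonneg _) (T.le_opNorm _) 2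
  have h5 : 0 ≤ τ / (2 * σ) * ‖y - y₀‖ ^ 2 := by positivity
  have h6 := mul_le_mul_of_nonneg_left h4 (half_pos hσ).le
  rw [h3, Real.norm_of_nonneg (add_nonneg h1.1 h5), Real.norm_of_nonneg (by positivity)]
  linarith [h1.2]

/-! ### The Fejér inequality -/

section Snipal

variable {τ σ ε : ℕ → ℝ} {y : ℕ → EuclideanSpace ℝ (Fin m)} {x : ℕ → EuclideanSpace ℝ (Fin n)}

/-- The residual of the linear constraint is controlled by the gradient tolerance. -/
theorem IsSnipalSequence.norm_residual_le (h : P.IsSnipalSequence σ τ ε y x) {k : ℕ}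
    (hσ : 0 < σ k) (hτ : 0 < τ k) :
    ‖σ k • (P.mulA (x (k + 1)) - P.b) + τ k • (y (k + 1) - y k)‖ ≤ min (√(τ k)) 1 * ε k := by
  have h1 := h.step_y k
  rw [(hasGradientAt_innerObj hσ hτ (h.step_x k)).gradient] at h1
  have h2 : σ k • (P.mulA (x (k + 1)) - P.b) + τ k • (y (k + 1) - y k) =
      σ k • (P.mulA (x (k + 1)) - P.b + (τ k / σ k) • (y (k + 1) - y k)) := by
    rw [smul_add, smul_smul, mul_div_cancel₀ _ hσ.ne']
  rw [h2, norm_smul, Real.norm_of_nonneg hσ.le]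
  calc _ ≤ σ k * (min (√(τ k)) 1 / σ k * ε k) := mul_le_mul_of_nonneg_left h1 hσ.le
    _ = _ := by field_simp

/-- The squared norm `τ ‖v‖² + ‖z‖²` on pairs. -/
noncomputable def weightedSq (t : ℝ) (v : EuclideanSpace ℝ (Fin m))
    (z : EuclideanSpace ℝ (Fin n)) : ℝ :=
  t * ‖v‖ ^ 2 + ‖z‖ ^ 2

theorem weightedSq_nonneg {t : ℝ} (ht : 0 ≤ t) (v : EuclideanSpace ℝ (Fin m))
    (z : EuclideanSpace ℝ (Fin n)) : 0 ≤ weightedSq t v z := by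
  unfold weightedSq
  positivity

/-- The projection inequality tested at `xs` is added to the KKT inequality tested at `x (k + 1)`.
Their coupling term is rewritten through the residual `e`, and polarization turns inner products
into squared distances. -/
theorem IsSnipalSequence.fejer (h : P.IsSnipalSequence σ τ ε y x) {k : ℕ}
    (hσ : 0 < σ k) (hτ : 0 < τ k) (hε : 0 ≤ ε k) {ys : EuclideanSpace ℝ (Fin m)}
    {xs : EuclideanSpace ℝ (Fin n)} (hs : P.IsKKT ys xs) :
    √(weightedSq (τ k) (y (k + 1) - ys) (x (k + 1) - xs)) ^ 2 +
        weightedSq (τ k) (y (k + 1) - y k) (x (k + 1) - x k) ≤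
      √(weightedSq (τ k) (y k - ys) (x k - xs)) ^ 2 +
        2 * ε k * √(weightedSq (τ k) (y (k + 1) - ys) (x (k + 1) - xs)) := by
  set e := σ k • (P.mulA (x (k + 1)) - P.b) + τ k • (y (k + 1) - y k) with he
  have h1 := (h.step_x k).inner_le_zero P.convex_K xs hs.mem_K
  have h2 := mul_nonneg hσ.le (hs.inner_nonneg _ (h.step_x k).1)
  have hid : ∀ {N : ℕ} (a a' b : EuclideanSpace ℝ (Fin N)),
      2 * ⟪a' - a, a' - b⟫ = ‖a' - b‖ ^ 2 + ‖a' - a‖ ^ 2 - ‖a - b‖ ^ 2 := fun a a' b => by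
    have := norm_sub_sq_real (a' - b) (a' - a)
    rw [sub_sub_sub_cancel_left, real_inner_comm] at this
    linarith
  have h3 : ⟪x k - σ k • (P.c - P.mulAT (y (k + 1))) - x (k + 1), xs - x (k + 1)⟫ =
      ⟪x (k + 1) - x k, x (k + 1) - xs⟫
        + σ k * ⟪P.c - P.mulAT (y (k + 1)), x (k + 1) - xs⟫ := by
    rw [← real_inner_smul_left, ← inner_add_left, ← neg_sub (x (k + 1)) xs, inner_neg_right,
      ← inner_neg_left]
    congr 1
    abel
  have h4 : σ k * ⟪P.c - P.mulAT ys, x (k + 1) - xs⟫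
      - σ k * ⟪P.c - P.mulAT (y (k + 1)), x (k + 1) - xs⟫
      = ⟪e, y (k + 1) - ys⟫ - τ k * ⟪y (k + 1) - y k, y (k + 1) - ys⟫ := by
    rw [← mul_sub, ← inner_sub_left, sub_sub_sub_cancel_left, ← map_sub, real_inner_comm,
      inner_mulAT, map_sub, hs.mulA_eq, he, inner_add_left, real_inner_smul_left,
      real_inner_smul_left]
    ring
  have h5 : ⟪e, y (k + 1) - ys⟫ ≤
      ε k * √(weightedSq (τ k) (y (k + 1) - ys) (x (k + 1) - xs)) := by
    -- The factor `√τ_k` in the tolerance converts `‖y (k + 1) - ys‖` into the weighted norm,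
    -- leaving the error `ε k`.
    have h6 : √(τ k) * ‖y (k + 1) - ys‖ ≤
        √(weightedSq (τ k) (y (k + 1) - ys) (x (k + 1) - xs)) := by
      refine Real.le_sqrt_of_sq_le ?_
      rw [mul_pow, Real.sq_sqrt hτ.le, weightedSq]
      exact le_add_of_nonneg_right (sq_nonneg _)
    calc ⟪e, y (k + 1) - ys⟫ ≤ ‖e‖ * ‖y (k + 1) - ys‖ := real_inner_le_norm _ _
      _ ≤ (√(τ k) * ε k) * ‖y (k + 1) - ys‖ := by
          refine mul_le_mul_of_nonneg_right ((h.norm_residual_le hσ hτ).trans ?_) (norm_nonneg _)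
          exact mul_le_mul_of_nonneg_right (min_le_left _ _) hε
      _ = ε k * (√(τ k) * ‖y (k + 1) - ys‖) := by ring
      _ ≤ _ := mul_le_mul_of_nonneg_left h6 hε
  rw [Real.sq_sqrt (weightedSq_nonneg hτ.le _ _), Real.sq_sqrt (weightedSq_nonneg hτ.le _ _)]
  have h7 := hid (x k) (x (k + 1)) xs
  have h8 := congrArg (τ k * ·) (hid (y k) (y (k + 1)) ys)
  rw [h3] at h1
  simp only [weightedSq] at h5 ⊢
  nlinarith [h1, h2, h4, h5, h7, h8]

end Snipal

end BoxLP

/-! ### Cluster points -/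

namespace BoxLP

variable {m n : ℕ} {P : BoxLP m n}
variable {τ σ ε : ℕ → ℝ} {y : ℕ → EuclideanSpace ℝ (Fin m)} {x : ℕ → EuclideanSpace ℝ (Fin n)}

/-- A cluster point of the iterates is a KKT point once the increments vanish. -/
theorem IsSnipalSequence.isKKT_of_tendsto (h : P.IsSnipalSequence σ τ ε y x)
    (hτpos : ∀ k, 0 < τ k) (hτanti : Antitone τ) (hσ0 : 0 < σ 0) (hσmono : Monotone σ)
    (hε : ∀ k, 0 ≤ ε k) (hε0 : Tendsto ε atTop (𝓝 0))
    (hdy : Tendsto (fun k => ‖y (k + 1) - y k‖) atTop (𝓝 0))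
    (hdx : Tendsto (fun k => ‖x (k + 1) - x k‖) atTop (𝓝 0))
    {φ : ℕ → ℕ} (hφ : StrictMono φ) {ys : EuclideanSpace ℝ (Fin m)}
    {xs : EuclideanSpace ℝ (Fin n)} (hy : Tendsto (fun k => y (φ k)) atTop (𝓝 ys))
    (hx : Tendsto (fun k => x (φ k)) atTop (𝓝 xs)) : P.IsKKT ys xs := by
  have hσ : ∀ k, σ 0 ≤ σ k := fun k => hσmono (Nat.zero_le k)
  -- The step conditions hold at index `φ k + 1`; vanishing increments give the shifted subsequences
  -- the same limits.
  have hy' : Tendsto (fun k => y (φ k + 1)) atTop (𝓝 ys) := by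
    simpa using hy.add ((tendsto_zero_iff_norm_tendsto_zero.2 hdy).comp hφ.tendsto_atTop)
  have hx' : Tendsto (fun k => x (φ k + 1)) atTop (𝓝 xs) := by
    simpa using hx.add ((tendsto_zero_iff_norm_tendsto_zero.2 hdx).comp hφ.tendsto_atTop)
  have hcA : Continuous P.mulA := P.mulA.continuous_of_finiteDimensional
  have hcT : Continuous P.mulAT := P.mulAT.continuous_of_finiteDimensional
  refine ⟨P.isClosed_K.mem_of_tendsto hx' (.of_forall fun k => (h.step_x _).1), ?_, fun s hs => ?_⟩
  · have h1 : Tendsto (fun k => P.mulA (x (k + 1)) - P.b) atTop (𝓝 0) := by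
      refine squeeze_zero_norm (a := fun k => (ε k + τ 0 * ‖y (k + 1) - y k‖) / σ 0)
        (fun k => ?_) ?_
      · have hk := hσ0.trans_le (hσ k)
        rw [le_div_iff₀ hσ0]
        have h2 := h.norm_residual_le hk (hτpos k)
        have h3 := norm_sub_le (σ k • (P.mulA (x (k + 1)) - P.b) + τ k • (y (k + 1) - y k))
          (τ k • (y (k + 1) - y k))
        rw [add_sub_cancel_right, norm_smul, norm_smul, Real.norm_of_nonneg hk.le,
          Real.norm_of_nonneg (hτpos k).le] at h3
        calc _ ≤ ‖P.mulA (x (k + 1)) - P.b‖ * σ k := by gcongr; exact hσ k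
          _ ≤ min (√(τ k)) 1 * ε k + τ k * ‖y (k + 1) - y k‖ := by linarith
          _ ≤ 1 * ε k + τ 0 * ‖y (k + 1) - y k‖ := by
              gcongr
              exacts [hε k, min_le_right _ _, hτanti (Nat.zero_le k)]
          _ = _ := by rw [one_mul]
      · simpa using (hε0.add (hdy.const_mul (τ 0))).div_const (σ 0)
    exact sub_eq_zero.1 (tendsto_nhds_unique
      (((hcA.tendsto xs).comp hx').sub_const P.b) (h1.comp hφ.tendsto_atTop))
  -- The projection inequality divided by `σ (φ k) ≥ σ 0`; no upper bound on `σ` is needed.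
  · have h1 : ∀ k, -(1 / σ 0 * (‖x (φ k + 1) - x (φ k)‖ * ‖s - x (φ k + 1)‖)) ≤
        ⟪P.c - P.mulAT (y (φ k + 1)), s - x (φ k + 1)⟫ := fun k => by
      have hk := hσ0.trans_le (hσ (φ k))
      have h2 := (h.step_x (φ k)).inner_le_zero P.convex_K s hs
      rw [sub_right_comm, inner_sub_left, real_inner_smul_left] at h2
      have h3 := real_inner_le_norm (x (φ k + 1) - x (φ k)) (s - x (φ k + 1))
      rw [← neg_sub (x (φ k)), inner_neg_left, norm_neg, norm_sub_rev] at h3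
      have h4 : -(1 / σ (φ k) * (‖x (φ k + 1) - x (φ k)‖ * ‖s - x (φ k + 1)‖)) ≤
          ⟪P.c - P.mulAT (y (φ k + 1)), s - x (φ k + 1)⟫ := by
        rw [neg_le, one_div, ← div_eq_inv_mul, le_div_iff₀ hk]
        linarith
      refine le_trans (neg_le_neg ?_) h4
      gcongr
      exact hσ (φ k)
    have h2 : Tendsto (fun k => s - x (φ k + 1)) atTop (𝓝 (s - xs)) := hx'.const_sub s
    have h3 : Tendsto (fun k => -(1 / σ 0 * (‖x (φ k + 1) - x (φ k)‖ * ‖s - x (φ k + 1)‖)))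
        atTop (𝓝 0) := by
      simpa using (((hdx.comp hφ.tendsto_atTop).mul h2.norm).const_mul (1 / σ 0)).neg
    exact le_of_tendsto_of_tendsto' h3
      ((((hcT.tendsto ys).comp hy').const_sub P.c).inner h2) h1

end BoxLP

/-! ### Convergence of the iterates -/

theorem mainTheorem2 {m n : ℕ} (P : BoxLP m n)
    (hP : P.primalSolutions.Nonempty) (hD : P.dualSolutions.Nonempty)
    (hA : P.A.rank = m)
    (τ : ℕ → ℝ) (τinf : ℝ) (hτpos : ∀ k, 0 < τ k) (hτanti : Antitone τ) (hτinf : 0 < τinf)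
    (hτlim : Tendsto τ atTop (𝓝 τinf))
    (σ : ℕ → ℝ) (σinf : EReal) (hσ0 : 0 < σ 0) (hσmono : Monotone σ)
    (hσlim : Tendsto (fun k => (σ k : EReal)) atTop (𝓝 σinf))
    (ε : ℕ → ℝ) (hε : ∀ k, 0 ≤ ε k) (hεsum : Summable ε)
    (y : ℕ → EuclideanSpace ℝ (Fin m)) (x : ℕ → EuclideanSpace ℝ (Fin n))
    (hyx : P.IsSnipalSequence σ τ ε y x) :
    Bornology.IsBounded (Set.range fun k => (y k, x k)) ∧
    (∃ xstar ∈ P.primalSolutions, Tendsto x atTop (𝓝 xstar)) ∧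
    (∃ ystar ∈ P.dualSolutions, Tendsto y atTop (𝓝 ystar)) := by
  have hσ : ∀ k, 0 < σ k := fun k => hσ0.trans_le (hσmono (Nat.zero_le k))
  have hτ : ∀ k, τinf ≤ τ k := hτanti.le_of_tendsto hτlim
  have hx_le : ∀ t : ℝ, τinf ≤ t → ∀ (v : EuclideanSpace ℝ (Fin m))
      (z : EuclideanSpace ℝ (Fin n)), ‖z‖ ≤ √(BoxLP.weightedSq t v z) := fun t ht v z =>
    Real.le_sqrt_of_sq_le
      (le_add_of_nonneg_left (mul_nonneg (hτinf.le.trans ht) (sq_nonneg _)))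
  have hy_le : ∀ t : ℝ, τinf ≤ t → ∀ (v : EuclideanSpace ℝ (Fin m))
      (z : EuclideanSpace ℝ (Fin n)), ‖v‖ ≤ √(BoxLP.weightedSq t v z) / √τinf :=
    fun t ht v z => by
      rw [le_div_iff₀ (Real.sqrt_pos.2 hτinf)]
      refine Real.le_sqrt_of_sq_le ?_
      rw [mul_pow, Real.sq_sqrt hτinf.le, mul_comm]
      exact (mul_le_mul_of_nonneg_right ht (sq_nonneg _)).trans
        (le_add_of_nonneg_right (sq_nonneg _))
  have hfejer : ∀ ys xs, P.IsKKT ys xs →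
      (∃ L, Tendsto (fun k => √(BoxLP.weightedSq (τ k) (y k - ys) (x k - xs))) atTop (𝓝 L)) ∧
        Tendsto (fun k => BoxLP.weightedSq (τ k) (y (k + 1) - y k) (x (k + 1) - x k))
          atTop (𝓝 0) := fun ys xs hs =>
    exists_tendsto_of_quasiFejer (fun _ => Real.sqrt_nonneg _)
      (fun k => BoxLP.weightedSq_nonneg (hτpos k).le _ _) hε hεsum
      -- Replacing the weight `τ k` by `τ (k + 1)` can only shrink the norm.
      (fun k => hyx.fejer (hσ k) (hτpos k) (hε k) hs) fun k => Real.sqrt_le_sqrt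
        (add_le_add_left (mul_le_mul_of_nonneg_right (hτanti k.le_succ) (sq_nonneg _)) _)
  obtain ⟨x₀, hx₀⟩ := hP
  obtain ⟨y₀, h₀⟩ := BoxLP.exists_isKKT hx₀
  obtain ⟨⟨L, hL⟩, hinc⟩ := hfejer y₀ x₀ h₀
  have hinc' := hinc.sqrt
  rw [Real.sqrt_zero] at hinc'
  have hdx : Tendsto (fun k => ‖x (k + 1) - x k‖) atTop (𝓝 0) :=
    squeeze_zero (fun _ => norm_nonneg _) (fun k => hx_le _ (hτ k) _ _) hinc'
  have hdy : Tendsto (fun k => ‖y (k + 1) - y k‖) atTop (𝓝 0) :=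
    squeeze_zero (fun _ => norm_nonneg _) (fun k => hy_le _ (hτ k) _ _)
      (by simpa using hinc'.div_const (√τinf))
  have hbdd : Bornology.IsBounded (Set.range fun k => (y k, x k)) := by
    obtain ⟨B, hB⟩ := hL.bddAbove_range
    refine (Metric.isBounded_closedBall (x := (y₀, x₀)) (r := max (B / √τinf) B)).subset ?_
    rintro _ ⟨k, rfl⟩
    have hk := hB ⟨k, rfl⟩
    rw [Metric.mem_closedBall, Prod.dist_eq, dist_eq_norm, dist_eq_norm]
    exact max_le_max ((hy_le _ (hτ k) _ _).trans
      (div_le_div_of_nonneg_right hk (Real.sqrt_nonneg _))) ((hx_le _ (hτ k) _ _).trans hk)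
  refine ⟨hbdd, ?_⟩
  obtain ⟨⟨ys, xs⟩, -, φ, hφ, hlim⟩ := tendsto_subseq_of_bounded hbdd fun k => ⟨k, rfl⟩
  have hys : Tendsto (fun k => y (φ k)) atTop (𝓝 ys) := (continuous_fst.tendsto _).comp hlim
  have hxs : Tendsto (fun k => x (φ k)) atTop (𝓝 xs) := (continuous_snd.tendsto _).comp hlim
  have hs : P.IsKKT ys xs := hyx.isKKT_of_tendsto hτpos hτanti hσ0 hσmono hε
    hεsum.tendsto_atTop_zero hdy hdx hφ hys hxs
  -- The Fejér argument again, now centred at the cluster point.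
  obtain ⟨⟨M, hM⟩, -⟩ := hfejer ys xs hs
  have hM0 : M = 0 := by
    refine tendsto_nhds_unique (hM.comp hφ.tendsto_atTop) ?_
    have h1 : Tendsto (fun k => y (φ k) - ys) atTop (𝓝 0) := tendsto_sub_nhds_zero_iff.2 hys
    have h2 : Tendsto (fun k => x (φ k) - xs) atTop (𝓝 0) := tendsto_sub_nhds_zero_iff.2 hxs
    have h3 := (((hτlim.comp hφ.tendsto_atTop).mul (h1.norm.pow 2)).add (h2.norm.pow 2)).sqrt
    simpa [BoxLP.weightedSq, Function.comp_def] using h3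
  subst hM0
  refine ⟨⟨xs, hs.mem_primalSolutions, ?_⟩, ⟨ys, hs.mem_dualSolutions, ?_⟩⟩
  · exact tendsto_iff_norm_sub_tendsto_zero.2
      (squeeze_zero (fun _ => norm_nonneg _) (fun k => hx_le _ (hτ k) _ _) hM)
  · exact tendsto_iff_norm_sub_tendsto_zero.2
      (squeeze_zero (fun _ => norm_nonneg _) (fun k => hy_le _ (hτ k) _ _)
        (by simpa using hM.div_const (√τinf)))
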